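/- Let $n$ be a positive integer, $[n]=\{1,\dots,n\}$ and $[\pm n]=\{\pm1,\dots,\pm n\}$. Let $S_n^B$ be the group of signed permutations, i.e. of the permutations $\sigma$ of $[\pm n]$ with $\sigma(-i)=-\sigma(i)$ for all $i$. Let $s_0\in S_n^B$ be the element that exchanges $1$ and $-1$ and fixes everything else, and for $1\le i\le n-1$ let $s_i\in S_n^B$ be the element that exchanges $i$ and $i+1$, exchanges $-i$ and $-(i+1)$, and fixes everything else. For $\sigma\in S_n^B$ put: - $\ell(\sigma)$, the length of $\sigma$: the least $k\ge 0$ such that $\sigma=s_{a_1}\cdots s_{a_k}$ for some $a_1,\dots,a_k\in\{0,\dots,n-1\}$; - $\mathrm{inv}(\sigma)=|\{(i,j)\in[n]^2: i<j,\ \sigma(i)>\sigma(j)\}|+|\{(i,j)\in[n]^2: i\le j,\ \sigma(-i)>\sigma(j)\}|$; - $\mathrm{wex}(\sigma)=|\{i\in[n]:\sigma(i)\ge i\}|$; - $\mathrm{al}_{nest}(\sigma)$, the number of pairs $(i,j)\in[n]^2$ with $-i<-j<-\sigma(j)<-\sigma(i)$, or $-i<j\le\sigma(j)<-\sigma(i)$,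 or $i<j\le\sigma(j)<\sigma(i)$; - $\mathrm{crs}(\sigma)$, the number of pairs $(i,j)\in[n]^2$ with $i<j\le\sigma(i)<\sigma(j)$, or $-i<-j<-\sigma(i)<-\sigma(j)$, or $-i<j\le-\sigma(i)<\sigma(j)$. Then for every $\sigma\in S_n^B$, $$\ell(\sigma)=\mathrm{inv}(\sigma)=2\,\mathrm{al}_{nest}(\sigma)+\mathrm{crs}(\sigma)+n-\mathrm{wex}(\sigma).$$ -/

import Mathlib

/-- The set `[±n] = {±1, …, ±n}` of integers. -/
noncomputable def SignedSet (n : ℕ) : Finset ℤ := (Finset.Icc (-(n : ℤ)) n).erase 0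

namespace SignedSet

theorem mem_iff {n : ℕ} {k : ℤ} : k ∈ SignedSet n ↔ k ≠ 0 ∧ -(n : ℤ) ≤ k ∧ k ≤ n := by
  simp [SignedSet]

/-- Negation `i ↦ -i` on `[±n]`. -/
noncomputable instance (n : ℕ) : InvolutiveNeg (SignedSet n) where
  neg i := ⟨-i.1, by have h := mem_iff.1 i.2; rw [mem_iff]; omega⟩
  neg_neg i := Subtype.ext (neg_neg i.1)

theorem coe_neg {n : ℕ} (i : SignedSet n) : ((-i : SignedSet n) : ℤ) = -(i : ℤ) := rfl

/-- The positive part `[n] = {1, …, n}` of `[±n]`. -/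
noncomputable def positives (n : ℕ) : Finset (SignedSet n) := Finset.univ.filter fun i => 0 < (i : ℤ)

/-- The element `k + 1` of `[n]`, for `k = 0, …, n - 1`. -/
noncomputable def ofFin {n : ℕ} (k : Fin n) : SignedSet n :=
  ⟨(k : ℤ) + 1, by rw [mem_iff]; omega⟩

end SignedSet

/-- The group `S_n^B` of signed permutations: the permutations `σ` of `[±n]` such that
`σ(-i) = -σ(i)`. -/
def SignedPerm (n : ℕ) : Subgroup (Equiv.Perm (SignedSet n)) where
  carrier := {σ | ∀ i, σ (-i) = -σ i}
  mul_mem' {σ τ} hσ hτ i := by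
    rw [Equiv.Perm.mul_apply, Equiv.Perm.mul_apply, hτ i, hσ (τ i)]
  one_mem' _ := rfl
  inv_mem' {σ} hσ i := by
    rw [Equiv.Perm.inv_eq_iff_eq, hσ (σ⁻¹ i), ← Equiv.Perm.mul_apply, mul_inv_cancel]
    rfl

namespace SignedPerm

open SignedSet

theorem swap_mem {n : ℕ} (a : SignedSet n) : Equiv.swap a (-a) ∈ SignedPerm n := by
  intro i
  simp only [Equiv.swap_apply_def, Subtype.ext_iff, coe_neg]
  split_ifs <;> (try simp only [coe_neg]) <;> omega

theorem swap_mul_swap_mem {n : ℕ} (a b : SignedSet n) (ha : 0 < (a : ℤ)) (hb : 0 < (b : ℤ)) :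
    Equiv.swap a b * Equiv.swap (-a) (-b) ∈ SignedPerm n := by
  intro i
  simp only [Equiv.Perm.mul_apply, Equiv.swap_apply_def, Subtype.ext_iff]
  split_ifs <;> simp_all only [coe_neg] <;> grind

/-- The generators `s_0, …, s_{n-1}` of the Coxeter system of type `B`: `s_0` exchanges `1` and
`-1`; for `i ≥ 1`, `s_i` exchanges `i` and `i + 1` (and hence also `-i` and `-(i + 1)`). All other
elements are fixed. -/
noncomputable def gen {n : ℕ} (i : Fin n) : SignedPerm n :=
  if (i : ℕ) = 0 then
    ⟨Equiv.swap (ofFin i) (-ofFin i), swap_mem _⟩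
  else
    let a : SignedSet n := ofFin ⟨(i : ℕ) - 1, by omega⟩
    let b : SignedSet n := ofFin i
    ⟨Equiv.swap a b * Equiv.swap (-a) (-b),
      swap_mul_swap_mem a b (by simp only [a, ofFin]; omega) (by simp only [b, ofFin]; omega)⟩

variable {n : ℕ}

/-- The length `ℓ(σ)`: the minimum of the `k` such that `σ = s_{a_1} ⋯ s_{a_k}`. -/
noncomputable def length (σ : SignedPerm n) : ℕ :=
  sInf {k | ∃ w : List (Fin n), w.length = k ∧ (w.map gen).prod = σ}

/-- The inversion number `inv(σ)`: the number of pairs in `[n] × [n]` with `i < j` and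
`σ(i) > σ(j)`, plus the number of pairs with `i ≤ j` and `σ(-i) > σ(j)`. A pair that satisfies both
conditions is counted twice. -/
noncomputable def inv (σ : SignedPerm n) : ℕ :=
  ((positives n ×ˢ positives n).filter fun (i, j) => i < j ∧ σ.1 i > σ.1 j).card +
  ((positives n ×ˢ positives n).filter fun (i, j) => i ≤ j ∧ σ.1 (-i) > σ.1 j).card

/-- The number `wex(σ)` of weak excedances, that is, of `i ∈ [n]` with `σ(i) ≥ i`. -/
noncomputable def wex (σ : SignedPerm n) : ℕ :=
  ((positives n).filter fun i => σ.1 i ≥ i).card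

/-- The set `A_nest(σ)` of nestings (alignments of nested type). -/
noncomputable def nestings (σ : SignedPerm n) : Finset (SignedSet n × SignedSet n) :=
  (positives n ×ˢ positives n).filter fun (i, j) =>
    (-i < -j ∧ -j < -σ.1 j ∧ -σ.1 j < -σ.1 i) ∨
    (-i < j ∧ j ≤ σ.1 j ∧ σ.1 j < -σ.1 i) ∨
    (i < j ∧ j ≤ σ.1 j ∧ σ.1 j < σ.1 i)

/-- The number `al_nest(σ)` of nestings. -/
noncomputable def alNest (σ : SignedPerm n) : ℕ := (nestings σ).card

/-- The set `C(σ)` of crossings. -/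
noncomputable def crossings (σ : SignedPerm n) : Finset (SignedSet n × SignedSet n) :=
  (positives n ×ˢ positives n).filter fun (i, j) =>
    (i < j ∧ j ≤ σ.1 i ∧ σ.1 i < σ.1 j) ∨
    (-i < -j ∧ -j < -σ.1 i ∧ -σ.1 i < -σ.1 j) ∨
    (-i < j ∧ j ≤ -σ.1 i ∧ -σ.1 i < σ.1 j)

/-- The number `crs(σ)` of crossings. -/
noncomputable def crs (σ : SignedPerm n) : ℕ := (crossings σ).card

end SignedPerm

/-!
Length: right multiplication by a generator changes `inv` by at most one, and if no generator
lowers `inv σ`, then the window `[σ(1), …, σ(n)]` is positive and increasing, so `σ = 1`.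

Second identity: let `c b` be the number of `j ≥ b` with `σ j < b`, where `b > 0`. For fixed `j > 0`
the nestings `(i, j)` and the crossings `(i, j)`, together with `1` if `σ j < j`, are counted by
`c j`; summing over `j` gives `al_nest + crs + (n - wex) = ∑ c`. On the other hand, the `a ∈ [±n]`
with `a < j` and `σ a > σ j` are as many as the nestings `(i, j)` plus the `b` with `σ j < b ≤ j`.
Summed over `j`, the latter contribute `∑ c` for `b > 0`, while those with `b < 0` are as many as
the pairs `j < i` with `σ i + σ j < 0`, which is the excess of the left-hand side over `inv`. Hence
`inv = al_nest + ∑ c`.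
-/

section WordLength

variable {ι G : Type*} [Monoid G] {s : ι → G} {f : G → ℕ}

theorem apply_prod_map_le_length (hone : f 1 = 0) (hle : ∀ g i, f (g * s i) ≤ f g + 1)
    (w : List ι) : f (w.map s).prod ≤ w.length := by
  induction w using List.reverseRecOn with
  | nil => exact hone.le
  | append_singleton w i ih =>
    rw [List.map_append, List.prod_append, List.map_singleton, List.prod_singleton,
      List.length_append, List.length_singleton]
    exact (hle _ i).trans (Nat.add_le_add_right ih 1)

theorem exists_word_length_le (hs : ∀ i, s i * s i = 1)
    (hdesc : ∀ g, g ≠ 1 → ∃ i, f (g * s i) < f g) (g : G) :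
    ∃ w : List ι, w.length ≤ f g ∧ (w.map s).prod = g := by
  induction hm : f g using Nat.strong_induction_on generalizing g with
  | _ m ih =>
    by_cases hg : g = 1
    · exact ⟨[], Nat.zero_le m, hg.symm⟩
    · obtain ⟨i, hi⟩ := hdesc g hg
      obtain ⟨w, hlen, hprod⟩ := ih _ (hm ▸ hi) (g * s i) rfl
      refine ⟨w ++ [i], ?_, ?_⟩
      · rw [List.length_append, List.length_singleton]
        omega
      · rw [List.map_append, List.prod_append, List.map_singleton, List.prod_singleton, hprod,
          mul_assoc, hs, mul_one]

theorem sInf_word_length_eq (hs : ∀ i, s i * s i = 1) (hone : f 1 = 0)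
    (hle : ∀ g i, f (g * s i) ≤ f g + 1) (hdesc : ∀ g, g ≠ 1 → ∃ i, f (g * s i) < f g) (g : G) :
    sInf {k | ∃ w : List ι, w.length = k ∧ (w.map s).prod = g} = f g := by
  obtain ⟨w, hlen, hprod⟩ := exists_word_length_le hs hdesc g
  have hmem : w.length ∈ {k | ∃ w : List ι, w.length = k ∧ (w.map s).prod = g} := ⟨w, rfl, hprod⟩
  refine le_antisymm ((Nat.sInf_le hmem).trans hlen) (le_csInf ⟨_, hmem⟩ ?_)
  rintro _ ⟨u, rfl, rfl⟩
  exact apply_prod_map_le_length hone hle u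

end WordLength

section AdjacentSwap

open Finset

variable {ι : Type*} [LinearOrder ι] {a b : ι}

theorem swap_lt_swap_of_covBy (hab : a ⋖ b) {x y : ι} (hxy : x < y) (hne : (x, y) ≠ (a, b)) :
    Equiv.swap a b x < Equiv.swap a b y := by
  have hlt := hab.lt
  have hbetween (c : ι) : c ≤ a ∨ b ≤ c := (le_or_gt c a).imp_right hab.ge_of_gt
  have hx := hbetween x
  have hy := hbetween y
  simp only [Equiv.swap_apply_def]
  grind

theorem sum_lt_comp_swap_add [Fintype ι] {M : Type*} [AddCommMonoid M] (hab : a ⋖ b)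
    (F : ι → ι → M) :
    ∑ x : ι × ι with x.1 < x.2, F (Equiv.swap a b x.1) (Equiv.swap a b x.2) + F a b =
      ∑ x : ι × ι with x.1 < x.2, F x.1 x.2 + F b a := by
  have hmem : (a, b) ∈ univ.filter fun x : ι × ι => x.1 < x.2 := by simp [hab.lt]
  let π := Prod.map (Equiv.swap a b) (Equiv.swap a b)
  have hπ (x : ι × ι) : π (π x) = x := by
    simp only [π, Prod.map_apply', Equiv.swap_apply_self]
  have hmaps : ∀ x ∈ (univ.filter fun x : ι × ι => x.1 < x.2).erase (a, b),
      π x ∈ (univ.filter fun x : ι × ι => x.1 < x.2).erase (a, b) := by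
    simp only [mem_erase, mem_filter, mem_univ, true_and]
    refine fun x ⟨hne, hlt⟩ => ⟨fun h => ?_, swap_lt_swap_of_covBy hab hlt hne⟩
    have hx : x = (b, a) := by rw [← hπ x, h]; simp [π]
    rw [hx] at hlt
    exact hlt.asymm hab.lt
  have hrest := sum_nbij' π π hmaps hmaps (fun x _ => hπ x) (fun x _ => hπ x)
    (f := fun x => F (Equiv.swap a b x.1) (Equiv.swap a b x.2)) (g := fun x => F x.1 x.2)
    fun _ _ => rfl
  rw [← add_sum_erase _ _ hmem, ← add_sum_erase _ _ hmem, hrest, Equiv.swap_apply_left,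
    Equiv.swap_apply_right, add_right_comm (F b a), add_comm (F b a),
    add_right_comm]

end AdjacentSwap

section FinsetCard

open Finset

variable {α β γ : Type*}

theorem card_eq_sum_card_fibers [DecidableEq α] [DecidableEq β] {s : Finset (α × β)}
    {t : Finset α} {u : Finset β} (h : s ⊆ t ×ˢ u) :
    #s = ∑ j ∈ u, #{i ∈ t | (i, j) ∈ s} := by
  rw [← inter_eq_right.2 h, ← filter_mem_eq_inter, card_filter, sum_product_right]
  simp only [card_filter, filter_mem_eq_inter, inter_eq_right.2 h]

theorem sum_card_filter_lt_le_comm [LinearOrder α] (s : Finset α) (f : α → α) :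
    ∑ j ∈ s, #{b ∈ s | f j < b ∧ b ≤ j} = ∑ b ∈ s, #{j ∈ s | b ≤ j ∧ f j < b} := by
  simp only [card_filter, and_comm]
  exact sum_comm

theorem card_product_filter_swap (s : Finset α) (p : α → α → Prop) [DecidableRel p] :
    #{x ∈ s ×ˢ s | p x.1 x.2} = #{x ∈ s ×ˢ s | p x.2 x.1} := by
  simp only [card_filter]
  rw [sum_product, sum_product_right]

theorem two_mul_card_filter_lt [LinearOrder β] {s : Finset α} {f : α → β} (hf : Set.InjOn f s)
    {r : α → α → Prop} [DecidableRel r] (hr : ∀ a b, r a b ↔ r b a) :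
    2 * #{x ∈ s ×ˢ s | f x.1 < f x.2 ∧ r x.1 x.2} = #{x ∈ s.offDiag | r x.1 x.2} := by
  classical
  have hsplit : s.offDiag.filter (fun x => r x.1 x.2) =
      {x ∈ s ×ˢ s | f x.1 < f x.2 ∧ r x.1 x.2} ∪ {x ∈ s ×ˢ s | f x.2 < f x.1 ∧ r x.2 x.1} := by
    ext ⟨a, b⟩
    simp only [mem_filter, mem_offDiag, mem_union, mem_product, hr b a]
    have hab (ha : a ∈ s) (hb : b ∈ s) : a ≠ b ↔ f a < f b ∨ f b < f a := by
      rw [lt_or_lt_iff_ne, ne_eq, ne_eq, hf.eq_iff ha hb]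
    tauto
  rw [hsplit, card_union_of_disjoint, two_mul,
    card_product_filter_swap s fun a b => f a < f b ∧ r a b]
  exact disjoint_filter.2 fun x _ hlt hgt => hlt.1.asymm hgt.1

theorem card_filter_lt_eq_card_filter_lt [LinearOrder β] [LinearOrder γ] {s : Finset α}
    {f : α → β} {g : α → γ} (hf : Set.InjOn f s) (hg : Set.InjOn g s) {r : α → α → Prop}
    [DecidableRel r] (hr : ∀ a b, r a b ↔ r b a) :
    #{x ∈ s ×ˢ s | f x.1 < f x.2 ∧ r x.1 x.2} = #{x ∈ s ×ˢ s | g x.1 < g x.2 ∧ r x.1 x.2} := by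
  have h := (two_mul_card_filter_lt hf hr).trans (two_mul_card_filter_lt hg hr).symm
  omega

end FinsetCard

section FinitePerm

open Finset

variable {α : Type*} [Fintype α] (π : Equiv.Perm α)

theorem card_filter_perm_apply (p : α → Prop) [DecidablePred p] : #{a | p (π a)} = #{a | p a} := by
  simp only [card_filter]
  exact Equiv.sum_comp π fun a => if p a then 1 else 0

variable [LinearOrder α]

theorem card_lt_and_le_perm_apply (b : α) :
    #{a | a < b ∧ b ≤ π a} = #{a | b ≤ a ∧ π a < b} := by
  have h := card_sdiff_comm (card_filter_perm_apply π (· < b)).symm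
  simpa only [← filter_and_not, not_lt, and_comm] using h

theorem card_inversions_left_add_card_le (b : α) :
    #{a | a < b ∧ π b < π a} + #{a | a ≤ π b} = #{a | b < a ∧ π a < π b} + #{a | a ≤ b} := by
  have hne (a : α) : π a = π b ↔ a = b := π.injective.eq_iff
  have hleft : univ.filter (fun a => a < b ∧ π b < π a) =
      univ.filter (· ≤ b) \ univ.filter (π · ≤ π b) := by
    ext a
    grind
  have hright : univ.filter (fun a => b < a ∧ π a < π b) =
      univ.filter (π · ≤ π b) \ univ.filter (· ≤ b) := by
    ext a
    have := hne a
    grind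
  rw [hleft, hright, ← card_filter_perm_apply π (· ≤ π b), card_sdiff_add_card,
    card_sdiff_add_card, union_comm]

theorem card_inversions_left_eq_of_lt {b : α} (h : π b < b) :
    #{a | a < b ∧ π b < π a} = #{a | b < a ∧ π a < π b} + #{a | π b < a ∧ a ≤ b} := by
  have hle : #{a | a ≤ b} = #{a | a ≤ π b} + #{a | π b < a ∧ a ≤ b} := by
    simp only [card_filter, ← sum_add_distrib]
    exact sum_congr rfl fun a _ => by grind
  have := card_inversions_left_add_card_le π b
  omega

theorem card_upper_nestings_add_card_upper_crossings {b : α} (h : b ≤ π b) :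
    #{a | a < b ∧ π b < π a} + #{a | a < b ∧ b ≤ π a ∧ π a < π b} = #{a | a < b ∧ b ≤ π a} := by
  simp only [card_filter, ← sum_add_distrib]
  refine sum_congr rfl fun a _ => ?_
  have : π a = π b ↔ a = b := π.injective.eq_iff
  grind

/-- The summand `1` accounts for `a = b`. -/
theorem card_lower_nestings_add_card_lower_crossings {b : α} (h : π b < b) :
    #{a | b < a ∧ π a < π b} + #{a | b < a ∧ π b < π a ∧ π a < b} + 1 =
      #{a | b ≤ a ∧ π a < b} := by
  have hone : 1 = #{a | a = b} := by rw [filter_eq' univ b, if_pos (mem_univ b), card_singleton]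
  rw [hone]
  simp only [card_filter, ← sum_add_distrib]
  refine sum_congr rfl fun a _ => ?_
  have : π a = π b ↔ a = b := π.injective.eq_iff
  grind

end FinitePerm

namespace SignedSet

open Finset

variable {n : ℕ}

theorem mem_positives {i : SignedSet n} : i ∈ positives n ↔ 0 < (i : ℤ) := by
  rw [positives, mem_filter, and_iff_right (mem_univ i)]

theorem coe_ne_zero (i : SignedSet n) : (i : ℤ) ≠ 0 := (mem_iff.1 i.2).1

theorem coe_ofFin (k : Fin n) : ((ofFin k : SignedSet n) : ℤ) = (k : ℤ) + 1 := rfl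

theorem ofFin_injective : Function.Injective (ofFin : Fin n → SignedSet n) := fun a b h => by
  have := congrArg Subtype.val h
  simp only [coe_ofFin] at this
  omega

theorem exists_ofFin_eq {i : SignedSet n} (hi : i ∈ positives n) : ∃ k : Fin n, ofFin k = i := by
  have hbounds := mem_iff.1 i.2
  rw [mem_positives] at hi
  exact ⟨⟨((i : ℤ) - 1).toNat, by omega⟩, Subtype.ext (by simp only [coe_ofFin]; omega)⟩

theorem positives_eq_map :
    positives n = univ.map ⟨(ofFin : Fin n → SignedSet n), ofFin_injective⟩ := by
  ext i
  simp only [mem_map, mem_univ, true_and, Function.Embedding.coeFn_mk]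
  refine ⟨exists_ofFin_eq, ?_⟩
  rintro ⟨k, rfl⟩
  rw [mem_positives, coe_ofFin]
  omega

theorem card_positives : #(positives n) = n := by
  rw [positives_eq_map, card_map, card_univ, Fintype.card_fin]

theorem sum_positives {M : Type*} [AddCommMonoid M] (f : SignedSet n → M) :
    ∑ i ∈ positives n, f i = ∑ k : Fin n, f (ofFin k) := by
  rw [positives_eq_map, sum_map, Function.Embedding.coeFn_mk]

theorem sum_univ_eq_sum_positives {M : Type*} [AddCommMonoid M] (f : SignedSet n → M) :
    ∑ a, f a = ∑ i ∈ positives n, (f i + f (-i)) := by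
  have hneg : ∑ i ∈ positives n, f (-i) = ∑ a : SignedSet n with ¬ 0 < a.1, f a := by
    refine sum_equiv (Equiv.neg _) (fun i => ?_) fun _ _ => rfl
    have := coe_ne_zero i
    simp only [mem_positives, mem_filter, mem_univ, true_and, Equiv.neg_apply, coe_neg]
    omega
  rw [sum_add_distrib, hneg, positives, sum_filter_add_sum_filter_not]

theorem card_filter_eq_add_neg (p : SignedSet n → Prop) [DecidablePred p] :
    #{a | p a} = #{i ∈ positives n | p i} + #{i ∈ positives n | p (-i)} := by
  simp only [card_filter, sum_univ_eq_sum_positives, sum_add_distrib]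

theorem card_filter_or_neg (p : SignedSet n → Prop) [DecidablePred p]
    (hp : ∀ i ∈ positives n, p i → ¬ p (-i)) :
    #{i ∈ positives n | p i ∨ p (-i)} = #{a | p a} := by
  rw [filter_or, card_union_of_disjoint (disjoint_filter.2 hp), card_filter_eq_add_neg]

theorem mem_positives_of_le {i j : SignedSet n} (hj : j ∈ positives n) (h : j ≤ i) :
    i ∈ positives n :=
  mem_positives.2 ((mem_positives.1 hj).trans_le h)

theorem filter_positives {p : SignedSet n → Prop} [DecidablePred p]
    (hp : ∀ i, p i → i ∈ positives n) : (positives n).filter p = univ.filter p := by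
  ext i
  simp only [mem_filter, mem_univ, true_and, and_iff_right_iff_imp]
  exact hp i

end SignedSet

namespace SignedPerm

open SignedSet Finset

variable {n : ℕ} (σ : SignedPerm n)

theorem apply_neg (i : SignedSet n) : σ.1 (-i) = -σ.1 i := σ.2 i

theorem coe_apply_neg (i : SignedSet n) : (σ.1 (-i) : ℤ) = -σ.1 i := by
  rw [apply_neg, coe_neg]

theorem abs_apply_injOn : Set.InjOn (fun i => |(σ.1 i : ℤ)|) (positives n) := by
  intro i hi j hj h
  rw [mem_coe, mem_positives] at hi hj
  rcases abs_eq_abs.1 h with h | h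
  · exact σ.1.injective (Subtype.ext h)
  · rw [← coe_apply_neg] at h
    have := congrArg Subtype.val (σ.1.injective (Subtype.ext h))
    rw [coe_neg] at this
    omega

theorem alNest_eq_sum :
    alNest σ = ∑ j ∈ positives n, #{i ∈ positives n | (i, j) ∈ nestings σ} :=
  card_eq_sum_card_fibers (filter_subset _ _)

theorem crs_eq_sum : crs σ = ∑ j ∈ positives n, #{i ∈ positives n | (i, j) ∈ crossings σ} :=
  card_eq_sum_card_fibers (filter_subset _ _)

/-- The number of elements of `[n]` that `σ` carries from the cut `{b, b + 1, …}` to its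
complement. Both `inv σ` and `al_nest(σ) + crs(σ)` are expressed through these numbers. -/
noncomputable def cutNumber (b : SignedSet n) : ℕ := #{j ∈ positives n | b ≤ j ∧ σ.1 j < b}

section Fibers

variable {σ} {i j : SignedSet n}

theorem mem_nestings_iff_of_le (hi : i ∈ positives n) (hj : j ∈ positives n) (h : j ≤ σ.1 j) :
    (i, j) ∈ nestings σ ↔ (i < j ∧ σ.1 j < σ.1 i) ∨ (-i < j ∧ σ.1 j < σ.1 (-i)) := by
  rw [mem_positives] at hi hj
  simp only [nestings, mem_filter, mem_product, mem_positives, hi, hj, true_and,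
    ← Subtype.coe_lt_coe, ← Subtype.coe_le_coe, coe_neg, coe_apply_neg] at h ⊢
  omega

theorem mem_nestings_iff_of_lt (hi : i ∈ positives n) (hj : j ∈ positives n) (h : σ.1 j < j) :
    (i, j) ∈ nestings σ ↔ j < i ∧ σ.1 i < σ.1 j := by
  rw [mem_positives] at hi hj
  simp only [nestings, mem_filter, mem_product, mem_positives, hi, hj, true_and,
    ← Subtype.coe_lt_coe, ← Subtype.coe_le_coe, coe_neg] at h ⊢
  omega

theorem mem_crossings_iff_of_le (hi : i ∈ positives n) (hj : j ∈ positives n) (h : j ≤ σ.1 j) :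
    (i, j) ∈ crossings σ ↔ (i < j ∧ j ≤ σ.1 i ∧ σ.1 i < σ.1 j) ∨
      (-i < j ∧ j ≤ σ.1 (-i) ∧ σ.1 (-i) < σ.1 j) := by
  rw [mem_positives] at hi hj
  simp only [crossings, mem_filter, mem_product, mem_positives, hi, hj, true_and,
    ← Subtype.coe_lt_coe, ← Subtype.coe_le_coe, coe_neg, coe_apply_neg] at h ⊢
  omega

theorem mem_crossings_iff_of_lt (hi : i ∈ positives n) (hj : j ∈ positives n) (h : σ.1 j < j) :
    (i, j) ∈ crossings σ ↔ j < i ∧ σ.1 j < σ.1 i ∧ σ.1 i < j := by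
  rw [mem_positives] at hi hj
  simp only [crossings, mem_filter, mem_product, mem_positives, hi, hj, true_and,
    ← Subtype.coe_lt_coe, ← Subtype.coe_le_coe, coe_neg] at h ⊢
  omega

theorem card_nestings_fiber_of_le (hj : j ∈ positives n) (h : j ≤ σ.1 j) :
    #{i ∈ positives n | (i, j) ∈ nestings σ} = #{a | a < j ∧ σ.1 j < σ.1 a} := by
  rw [filter_congr fun i hi => mem_nestings_iff_of_le hi hj h,
    card_filter_or_neg fun a => a < j ∧ σ.1 j < σ.1 a]
  intro i _
  rw [mem_positives] at hj
  simp only [← Subtype.coe_lt_coe, ← Subtype.coe_le_coe, coe_apply_neg] at h ⊢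
  omega

theorem card_crossings_fiber_of_le (hj : j ∈ positives n) (h : j ≤ σ.1 j) :
    #{i ∈ positives n | (i, j) ∈ crossings σ} = #{a | a < j ∧ j ≤ σ.1 a ∧ σ.1 a < σ.1 j} := by
  rw [filter_congr fun i hi => mem_crossings_iff_of_le hi hj h,
    card_filter_or_neg fun a => a < j ∧ j ≤ σ.1 a ∧ σ.1 a < σ.1 j]
  intro i _
  rw [mem_positives] at hj
  simp only [← Subtype.coe_lt_coe, ← Subtype.coe_le_coe, coe_apply_neg]
  omega

theorem card_nestings_fiber_of_lt (hj : j ∈ positives n) (h : σ.1 j < j) :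
    #{i ∈ positives n | (i, j) ∈ nestings σ} = #{a | j < a ∧ σ.1 a < σ.1 j} := by
  rw [filter_congr fun i hi => mem_nestings_iff_of_lt hi hj h,
    filter_positives fun i hi => mem_positives_of_le hj hi.1.le]

theorem card_crossings_fiber_of_lt (hj : j ∈ positives n) (h : σ.1 j < j) :
    #{i ∈ positives n | (i, j) ∈ crossings σ} = #{a | j < a ∧ σ.1 j < σ.1 a ∧ σ.1 a < j} := by
  rw [filter_congr fun i hi => mem_crossings_iff_of_lt hi hj h,
    filter_positives fun i hi => mem_positives_of_le hj hi.1.le]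

theorem card_nestings_fiber_add_card_crossings_fiber (hj : j ∈ positives n) :
    #{i ∈ positives n | (i, j) ∈ nestings σ} + #{i ∈ positives n | (i, j) ∈ crossings σ} +
      (if σ.1 j < j then 1 else 0) = cutNumber σ j := by
  rw [cutNumber, filter_positives (p := fun i => j ≤ i ∧ σ.1 i < j) fun i hi =>
    mem_positives_of_le hj hi.1]
  rcases le_or_gt j (σ.1 j) with h | h
  · rw [card_nestings_fiber_of_le hj h, card_crossings_fiber_of_le hj h, if_neg h.not_gt, add_zero,
      card_upper_nestings_add_card_upper_crossings σ.1 h, card_lt_and_le_perm_apply]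
  · rw [card_nestings_fiber_of_lt hj h, card_crossings_fiber_of_lt hj h, if_pos h,
      card_lower_nestings_add_card_lower_crossings σ.1 h]

theorem card_inversions_left_eq_card_nestings_fiber_add (hj : j ∈ positives n) :
    #{a | a < j ∧ σ.1 j < σ.1 a} =
      #{i ∈ positives n | (i, j) ∈ nestings σ} + #{b | σ.1 j < b ∧ b ≤ j} := by
  rcases le_or_gt j (σ.1 j) with h | h
  · have hempty : univ.filter (fun b => σ.1 j < b ∧ b ≤ j) = ∅ :=
      filter_eq_empty_iff.2 fun b _ hb => (hb.1.trans_le hb.2).not_ge h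
    rw [card_nestings_fiber_of_le hj h, hempty, card_empty, add_zero]
  · rw [card_nestings_fiber_of_lt hj h, card_inversions_left_eq_of_lt σ.1 h]

end Fibers

theorem inv_add_card_negative_sums_eq :
    inv σ + #{x ∈ positives n ×ˢ positives n | x.2 < x.1 ∧ σ.1 x.2 < σ.1 (-x.1)} =
      ∑ j ∈ positives n, #{a | a < j ∧ σ.1 j < σ.1 a} := by
  simp only [inv, card_filter, sum_product_right, ← sum_add_distrib, sum_univ_eq_sum_positives]
  refine sum_congr rfl fun j hj => sum_congr rfl fun i hi => ?_
  have hneg : -i < j := by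
    rw [mem_positives] at hi hj
    rw [← Subtype.coe_lt_coe, coe_neg]
    omega
  grind

theorem card_negative_sums_eq :
    #{x ∈ positives n ×ˢ positives n | x.2 < x.1 ∧ σ.1 x.2 < σ.1 (-x.1)} =
      ∑ j ∈ positives n, #{b : SignedSet n | σ.1 j < b ∧ b.1 < 0} := by
  have hsymm (i j : SignedSet n) : σ.1 i < σ.1 (-j) ↔ σ.1 j < σ.1 (-i) := by
    simp only [← Subtype.coe_lt_coe, coe_apply_neg]
    omega
  -- As `σ i + σ j < 0` is symmetric in `i` and `j`, pairs may be ordered by `|σ i|` instead of `i`.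
  have hreorder :
      #{x ∈ positives n ×ˢ positives n | x.2 < x.1 ∧ σ.1 x.2 < σ.1 (-x.1)} =
        #{x ∈ positives n ×ˢ positives n |
          |(σ.1 x.1 : ℤ)| < |(σ.1 x.2 : ℤ)| ∧ σ.1 x.1 < σ.1 (-x.2)} := by
    rw [card_product_filter_swap _ fun i j => j < i ∧ σ.1 j < σ.1 (-i)]
    exact card_filter_lt_eq_card_filter_lt (f := id) (Set.injOn_id _) (abs_apply_injOn σ) hsymm
  rw [hreorder]
  simp only [card_filter, sum_product_right]
  refine sum_congr rfl fun j _ => ?_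
  rw [← card_filter, ← card_filter, ← card_filter_perm_apply σ.1 fun b => σ.1 j < b ∧ b.1 < 0,
    card_filter_eq_add_neg]
  simp only [card_filter, ← sum_add_distrib]
  refine sum_congr rfl fun i _ => ?_
  have hi := coe_ne_zero (σ.1 i)
  simp only [← Subtype.coe_lt_coe, coe_apply_neg]
  rcases abs_cases (σ.1 i : ℤ) with ⟨h, h'⟩ | ⟨h, h'⟩ <;>
    rcases abs_cases (σ.1 j : ℤ) with ⟨k, k'⟩ | ⟨k, k'⟩ <;> split_ifs <;> omega

theorem inv_eq_alNest_add : inv σ = alNest σ + ∑ b ∈ positives n, cutNumber σ b := by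
  have hsplit {j : SignedSet n} (hj : j ∈ positives n) : #{b | σ.1 j < b ∧ b ≤ j} =
      #{b ∈ positives n | σ.1 j < b ∧ b ≤ j} + #{b : SignedSet n | σ.1 j < b ∧ b.1 < 0} := by
    rw [mem_positives] at hj
    simp only [card_filter, sum_univ_eq_sum_positives, ← sum_add_distrib]
    refine sum_congr rfl fun b hb => ?_
    rw [mem_positives] at hb
    simp only [← Subtype.coe_lt_coe, ← Subtype.coe_le_coe, coe_neg]
    grind
  have hsum := inv_add_card_negative_sums_eq σ
  rw [sum_congr rfl fun j hj => card_inversions_left_eq_card_nestings_fiber_add hj,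
    sum_add_distrib, sum_congr rfl fun j hj => hsplit hj, sum_add_distrib, ← card_negative_sums_eq,
    sum_card_filter_lt_le_comm, ← alNest_eq_sum] at hsum
  simp only [cutNumber]
  omega

theorem alNest_add_crs_add :
    alNest σ + crs σ + n =
      wex σ + ∑ b ∈ positives n, cutNumber σ b := by
  have hexc : wex σ + #{j ∈ positives n | σ.1 j < j} = n := by
    simpa only [wex, ge_iff_le, not_le, card_positives] using
      card_filter_add_card_filter_not (s := positives n) fun j => j ≤ σ.1 j
  rw [← sum_congr rfl fun j hj => card_nestings_fiber_add_card_crossings_fiber hj]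
  simp only [sum_add_distrib, ← card_filter]
  rw [← alNest_eq_sum, ← crs_eq_sum]
  omega

theorem inv_add_wex : inv σ + wex σ = 2 * alNest σ + crs σ + n := by
  have := inv_eq_alNest_add σ
  have := alNest_add_crs_add σ
  omega

end SignedPerm

section WindowInv

open Finset

/-- The number of ways, at most two, in which values `x` and `y` at positions `i < j` of a signed
permutation contribute to its inversion number: `x > y` and `-x > y`. -/
def inversionWeight (x y : ℤ) : ℕ := (if y < x then 1 else 0) + (if x + y < 0 then 1 else 0)

theorem inversionWeight_neg_left (x y : ℤ) : inversionWeight (-x) y = inversionWeight x y := by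
  simp only [inversionWeight]
  grind

variable {ι : Type*} [Fintype ι] [LinearOrder ι] {v : ι → ℤ} {a b : ι}

/-- The inversion number of type `B` of the signed permutation with window `v`, as a function of
the window alone. -/
def windowInv (v : ι → ℤ) : ℕ :=
  ∑ x : ι × ι with x.1 < x.2, inversionWeight (v x.1) (v x.2) + #{k | v k < 0}

theorem windowInv_comp_swap_add (hab : a ⋖ b) :
    windowInv (v ∘ Equiv.swap a b) + (if v b < v a then 1 else 0) =
      windowInv v + (if v a < v b then 1 else 0) := by
  have hpairs := sum_lt_comp_swap_add hab fun k l => inversionWeight (v k) (v l)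
  have hneg := card_filter_perm_apply (Equiv.swap a b) fun k => v k < 0
  simp only [windowInv, Function.comp_apply]
  simp only [inversionWeight, add_comm (v b)] at hpairs ⊢
  omega

theorem windowInv_update_neg_add (ha : IsMin a) :
    windowInv (Function.update v a (-v a)) + (if v a < 0 then 1 else 0) =
      windowInv v + (if 0 < v a then 1 else 0) := by
  have hpairs (x : ι × ι) (hx : x.1 < x.2) :
      inversionWeight (Function.update v a (-v a) x.1) (Function.update v a (-v a) x.2) =
        inversionWeight (v x.1) (v x.2) := by
    rw [Function.update_of_ne fun h => ha.not_lt (hx.trans_eq h), Function.update_apply]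
    split_ifs with h
    · rw [h, inversionWeight_neg_left]
    · rfl
  have hneg : #{k | Function.update v a (-v a) k < 0} + (if v a < 0 then 1 else 0) =
      #{k | v k < 0} + (if 0 < v a then 1 else 0) := by
    have hrest : ∀ k ∈ univ.erase a,
        (if Function.update v a (-v a) k < 0 then 1 else 0) = if v k < 0 then 1 else 0 :=
      fun k hk => by rw [Function.update_of_ne (ne_of_mem_erase hk)]
    simp only [card_filter]
    rw [← add_sum_erase _ _ (mem_univ a), ← add_sum_erase _ _ (mem_univ a), sum_congr rfl hrest,
      Function.update_self]
    split_ifs <;> omega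
  rw [windowInv, windowInv, sum_congr rfl fun x hx => hpairs x (mem_filter.1 hx).2]
  omega

end WindowInv

namespace SignedPerm

open SignedSet Finset

variable {n : ℕ} (σ : SignedPerm n)

/-- The window notation `[σ(1), …, σ(n)]` of `σ`, indexed from `0`. -/
noncomputable def window (k : Fin n) : ℤ := σ.1 (ofFin k)

theorem window_one (k : Fin n) : window (1 : SignedPerm n) k = k + 1 := rfl

theorem window_ne_zero (k : Fin n) : window σ k ≠ 0 := coe_ne_zero _

theorem window_injective : Function.Injective (window : SignedPerm n → Fin n → ℤ) := by
  intro σ τ h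
  have hpos (i : SignedSet n) (hi : i ∈ positives n) : σ.1 i = τ.1 i := by
    obtain ⟨k, rfl⟩ := exists_ofFin_eq hi
    exact Subtype.ext (congrFun h k)
  refine Subtype.ext (Equiv.ext fun i => ?_)
  by_cases hi : i ∈ positives n
  · exact hpos i hi
  · have hneg : -i ∈ positives n := by
      have := coe_ne_zero i
      rw [mem_positives] at hi ⊢
      rw [coe_neg]
      omega
    rw [← neg_neg i, apply_neg σ, apply_neg τ, hpos _ hneg]

theorem inv_eq_windowInv : inv σ = windowInv (window σ) := by
  have hdiag : #{k | window σ k < 0} =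
      ∑ k : Fin n, ∑ l : Fin n, if k = l ∧ window σ k < 0 then 1 else 0 := by
    simp only [card_filter, ite_and, sum_ite_eq, mem_univ, if_true]
  simp only [inv, windowInv, hdiag, card_filter, sum_filter, sum_product, sum_positives,
    ← univ_product_univ, ← sum_add_distrib]
  refine sum_congr rfl fun k _ => sum_congr rfl fun l _ => ?_
  simp only [gt_iff_lt, ← Subtype.coe_lt_coe, ← Subtype.coe_le_coe, coe_apply_neg, coe_ofFin,
    inversionWeight, window, Fin.lt_def, Fin.ext_iff]
  grind

theorem ofFin_ne_neg_ofFin (k l : Fin n) : ofFin k ≠ -ofFin l := fun h => by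
  have := congrArg Subtype.val h
  rw [coe_neg, coe_ofFin, coe_ofFin] at this
  omega

theorem window_mul_gen_of_isMin {i : Fin n} (hi : IsMin i) :
    window (σ * gen i) = Function.update (window σ) i (-window σ i) := by
  have hi0 : (i : ℕ) = 0 := by
    have : NeZero n := ⟨i.pos.ne'⟩
    rw [hi.eq_bot, bot_eq_zero, Fin.val_zero]
  funext k
  have hgen : window (σ * gen i) k = σ.1 (Equiv.swap (ofFin i) (-ofFin i) (ofFin k)) := by
    rw [gen, if_pos hi0]
    rfl
  rw [hgen, Function.update_apply]
  split_ifs with hk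
  · rw [hk, Equiv.swap_apply_left, coe_apply_neg, window]
  · rw [Equiv.swap_apply_of_ne_of_ne (ofFin_injective.ne hk) (ofFin_ne_neg_ofFin k i), window]

theorem window_mul_gen_of_covBy {a i : Fin n} (hai : a ⋖ i) :
    window (σ * gen i) = window σ ∘ Equiv.swap a i := by
  have hval : (a : ℕ) + 1 = i := by rwa [Fin.covBy_iff, Nat.covBy_iff_add_one_eq] at hai
  have ha : (⟨(i : ℕ) - 1, by omega⟩ : Fin n) = a := Fin.ext (by simp only; omega)
  funext k
  have hgen : window (σ * gen i) k = σ.1 (Equiv.swap (ofFin a) (ofFin i)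
      (Equiv.swap (-ofFin a) (-ofFin i) (ofFin k))) := by
    rw [gen, if_neg (by omega), ← ha]
    rfl
  rw [hgen, Equiv.swap_apply_of_ne_of_ne (ofFin_ne_neg_ofFin k a) (ofFin_ne_neg_ofFin k i),
    ofFin_injective.swap_apply, Function.comp_apply, window]

theorem inv_mul_gen_of_isMin {i : Fin n} (hi : IsMin i) :
    inv (σ * gen i) + (if window σ i < 0 then 1 else 0) =
      inv σ + (if 0 < window σ i then 1 else 0) := by
  rw [inv_eq_windowInv, inv_eq_windowInv, window_mul_gen_of_isMin σ hi,
    windowInv_update_neg_add hi]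

theorem inv_mul_gen_of_covBy {a i : Fin n} (hai : a ⋖ i) :
    inv (σ * gen i) + (if window σ i < window σ a then 1 else 0) =
      inv σ + (if window σ a < window σ i then 1 else 0) := by
  rw [inv_eq_windowInv, inv_eq_windowInv, window_mul_gen_of_covBy σ hai,
    windowInv_comp_swap_add hai]

theorem isMin_or_exists_covBy (i : Fin n) : IsMin i ∨ ∃ a, a ⋖ i :=
  or_iff_not_imp_left.2 fun hi => ⟨_, Order.pred_covBy_of_not_isMin hi⟩

theorem gen_mul_gen (i : Fin n) : gen i * gen i = 1 := by
  apply window_injective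
  rcases isMin_or_exists_covBy i with hi | ⟨a, hai⟩
  · rw [window_mul_gen_of_isMin _ hi, ← one_mul (gen i), window_mul_gen_of_isMin _ hi,
      Function.update_idem, Function.update_self, neg_neg, Function.update_eq_self]
  · rw [window_mul_gen_of_covBy _ hai, ← one_mul (gen i), window_mul_gen_of_covBy _ hai,
      Function.comp_assoc, ← Equiv.coe_trans, Equiv.swap_swap, Equiv.coe_refl, Function.comp_id]

theorem inv_mul_gen_le (i : Fin n) : inv (σ * gen i) ≤ inv σ + 1 := by
  rcases isMin_or_exists_covBy i with hi | ⟨a, hai⟩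
  · have := inv_mul_gen_of_isMin σ hi
    split_ifs at this <;> omega
  · have := inv_mul_gen_of_covBy σ hai
    split_ifs at this <;> omega

theorem inv_one : inv (1 : SignedPerm n) = 0 := by
  have hpairs (x : Fin n × Fin n) (hx : x ∈ univ.filter fun x : Fin n × Fin n => x.1 < x.2) :
      inversionWeight (window 1 x.1) (window 1 x.2) = 0 := by
    have := (mem_filter.1 hx).2
    rw [inversionWeight, window_one, window_one, if_neg (by omega), if_neg (by omega)]
  rw [inv_eq_windowInv, windowInv, sum_eq_zero hpairs, zero_add, card_filter_eq_zero_iff]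
  intro k _
  rw [window_one]
  omega

variable {σ}

theorem window_pos_of_isMin {i : Fin n} (h : inv σ ≤ inv (σ * gen i)) (hi : IsMin i) :
    0 < window σ i := by
  have := inv_mul_gen_of_isMin σ hi
  have := window_ne_zero σ i
  grind

theorem window_lt_window_of_covBy {a i : Fin n} (h : inv σ ≤ inv (σ * gen i)) (hai : a ⋖ i) :
    window σ a < window σ i := by
  have hne : window σ a ≠ window σ i := fun heq =>
    hai.lt.ne (ofFin_injective (σ.1.injective (Subtype.ext heq)))
  have := inv_mul_gen_of_covBy σ hai
  grind

theorem eq_one_of_strictMono_window (hpos : ∀ k, 0 < window σ k) (hmono : StrictMono (window σ)) :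
    σ = 1 := by
  have hcard : #(Icc (1 : ℤ) n) = n := by simp
  have hσ : window σ = (Icc (1 : ℤ) n).orderEmbOfFin hcard :=
    orderEmbOfFin_unique hcard (fun k => mem_Icc.2 ⟨hpos k, (mem_iff.1 (σ.1 (ofFin k)).2).2.2⟩)
      hmono
  have hone : window (1 : SignedPerm n) = (Icc (1 : ℤ) n).orderEmbOfFin hcard :=
    orderEmbOfFin_unique hcard
      (fun k => by rw [mem_Icc, window_one]; omega)
      (fun k l hkl => by rw [window_one, window_one]; omega)
  exact window_injective (hσ.trans hone.symm)

theorem exists_inv_mul_gen_lt (hσ : σ ≠ 1) : ∃ i, inv (σ * gen i) < inv σ := by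
  by_contra! h
  have hmono : StrictMono (window σ) := strictMono_of_pred_lt fun i hi =>
    window_lt_window_of_covBy (h i) (Order.pred_covBy_of_not_isMin hi)
  have hpos (k : Fin n) : 0 < window σ k := by
    have : NeZero n := ⟨k.pos.ne'⟩
    exact (window_pos_of_isMin (h ⊥) isMin_bot).trans_le (hmono.monotone bot_le)
  exact hσ (eq_one_of_strictMono_window hpos hmono)

theorem length_eq_inv (σ : SignedPerm n) : length σ = inv σ :=
  sInf_word_length_eq gen_mul_gen inv_one inv_mul_gen_le (fun _ => exists_inv_mul_gen_lt) σ

end SignedPerm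

theorem corollary4p4 (n : ℕ) (σ : SignedPerm n) :
    SignedPerm.length σ = SignedPerm.inv σ ∧
    (SignedPerm.inv σ : ℤ) =
      2 * (SignedPerm.alNest σ : ℤ) + (SignedPerm.crs σ : ℤ) + (n : ℤ)
        - (SignedPerm.wex σ : ℤ) := by
  have hinv := SignedPerm.inv_add_wex σ
  exact ⟨SignedPerm.length_eq_inv σ, by omega⟩
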